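/- Let $\rho_w,\rho_r\in[0,1]$ with $\rho_w+\rho_r<1$, $\beta\in(0,\tfrac12)$, $T\ge 1$, and for $N=2^n$ put $\delta_N=2^{-N^\beta}$. **Channels.** For $S\subseteq\{1,\dots,N\}$ let $W_S^{1:N}$ be the sequence of binary erasure channels with erasure probability $1$ at the positions in $S$ and $0$ elsewhere, let $W_{S,N}^{(i)}$, $1\le i\le N$, be the channels generated from it by the polarization recursion (with kernel $W^-(y^1,y^2|u^1)=\sum_{u^2}\frac12W^1(y^1|u^1\oplus u^2)W^2(y^2|u^2)$, $W^+(y^1,y^2,u^1|u^2)=\frac12W^1(y^1|u^1\oplus u^2)W^2(y^2|u^2)$), and let $Z_S^{(i)}$ be the Bhattacharyya parameter of $W_{S,N}^{(i)}$. A random set $S$ has fraction $\rho$ if either every position belongs to $S$ with probability $\rho$, independently of the others, or $S$ is uniformly distributed among the $k$-element subsets, where $k$ is an integer with $|k-\rho N|<1$ (so $k=\rho N$ if this is an integer). For a law of $S$ of fraction $\rho$ put $P_\rho^{(i)}=\Pr\{Z_S^{(i)}=1\}$. **Scheme.** Let $\mathcal L_w=\{i:P_{\rho_w}^{(i)}\le\delta_N\}$,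 $\mathcal H_r=\{i:P_{1-\rho_r}^{(i)}\ge1-\delta_N\}$, $\mathcal I=\mathcal L_w\cap\mathcal H_r$, $\mathcal R=\mathcal L_w\cap\mathcal H_r^c$, $\mathcal F=\mathcal L_w^c\cap\mathcal H_r$, $\mathcal B=\mathcal L_w^c\cap\mathcal H_r^c$, and let $\mathcal E\subseteq\mathcal I$ with $|\mathcal E|=|\mathcal B|$, with a fixed bijection $\mathcal B\to\mathcal E$. In each of $T$ blocks a vector $u^N\in\{0,1\}^N$ carries message bits on $\mathcal I\setminus\mathcal E$, independent uniform random bits on $\mathcal E\cup\mathcal R$, public frozen bits on $\mathcal F$, and on $\mathcal B$ uniform pre-shared bits (first block) or the bits of $u^{\mathcal E}$ of the preceding block (later blocks); $x^N=u^N\mathbf G_N$, $\mathbf G_N=\mathbf R\mathbf F^{\otimes n}$, is transmitted, where $\mathbf R$ is the bit-reversal matrix and $\mathbf F=\begin{pmatrix}1&0\\1&1\end{pmatrix}$. In block $t$ the adversary replaces $x^i$ by "?" for $i\in S_t$, where each $S_t$ is random of fraction $\rho_w$ and $(S_1,\dots,S_T)$ is independent of the transmitted data (the joint law of $S_1,\dots,S_T$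 is otherwise arbitrary; in particular the sets may be equal or independent). The law of each $S_t$ is the one from which $\mathcal L_w$ is computed, or $\mathcal L_w$ is computed from the law with independent erasures. The receiver uses successive-cancellation decoding: on $\mathcal I\cup\mathcal R$, $\hat u^i$ maximizes the likelihood of the $i$-th generated channel given $y^{1:N},\hat u^{1:i-1}$, for the initial channel $\rho_wV_{\epsilon_1}+(1-\rho_w)V_{\epsilon_0}$ ($V_{\epsilon_1},V_{\epsilon_0}$ the erasure channels with erasure probability $1$ and $0$), ties being broken arbitrarily; on $\mathcal F$ and on $\mathcal B$ it uses the frozen bits, the pre-shared bits (first block) and the decoded bits $\hat u^{\mathcal E}$ of the preceding block (later blocks). **Claim.** Let the law of the message and the frozen bits be arbitrary. For given sets $S_1,\dots,S_T$ in the support of the law of the adversary's sets, let $\mathrm P_e(T)$ be the probability that some $u^N$ is decoded incorrectly; it is at least $\Pr(\hat M\ne M)$. (1) For all $N$ and all such $S_1,\dots,S_T$, $$\mathrm P_e(T)\le\sum_{t=1}^{T}\sum_{i\in\mathcal I\cup\mathcal R}Z_{S_t}^{(i)}+\sum_{t=1}^{T-1}\sum_{i\in\mathcal E}Z_{S_t}^{(i)},$$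 and the right-hand side is $T\sum_{i\in\mathcal I\cup\mathcal R}Z_{S}^{(i)}+(T-1)\sum_{i\in\mathcal E}Z_{S}^{(i)}$ if all $S_t$ equal $S$. (2) As $N\to\infty$, with $T,\beta,\rho_w,\rho_r$ fixed, the probability (over $S_1,\dots,S_T$) that this right-hand side is $0$ tends to $1$, hence $\Pr\{\mathrm P_e(T)=0\}\to1$, and $\Pr(\hat M\ne M)$, averaged over $S_1,\dots,S_T$, tends to $0$; the convergence is uniform in all choices of the scheme ($\mathcal E$, the bijection, the frozen bits), of the decoder's tie-breaking, of the message law and of the joint law of $S_1,\dots,S_T$. -/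

import Mathlib

open Filter

noncomputable section

namespace AWTC

/-! Probabilities of events under a discrete law. -/

/-- `Pr_{x ∼ μ}{x ∈ A}` as a real number. -/
def prob {α : Type} (μ : PMF α) (A : Set α) : ℝ := (μ.toOuterMeasure A).toReal

/-! Binary-input discrete memoryless channels and the polarization kernel. -/

/-- A channel with input alphabet `{0,1}` and a finite output alphabet `Out`;
`tr x y` is the transition probability `W(y | x)`. -/
structure BDMC where
  Out : Type
  fintypeOut : Fintype Out
  tr : ZMod 2 → Out → ℝ
  tr_nonneg : ∀ x y, 0 ≤ tr x y
  tr_sum : ∀ x, ∑ y, tr x y = 1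

attribute [instance] BDMC.fintypeOut

/-- The Bhattacharyya parameter `Z(W) = ∑_y √(W(y|0) W(y|1))`. -/
def BDMC.Z (W : BDMC) : ℝ := ∑ y, Real.sqrt (W.tr 0 y * W.tr 1 y)

/-- `W⁻(y¹,y² | u¹) = ∑_{u²} ½ W¹(y¹ | u¹ ⊕ u²) W²(y² | u²)`. -/
def BDMC.minus (W₁ W₂ : BDMC) : BDMC where
  Out := W₁.Out × W₂.Out
  fintypeOut := inferInstance
  tr u₁ y := ∑ u₂ : ZMod 2, (1 / 2 : ℝ) * W₁.tr (u₁ + u₂) y.1 * W₂.tr u₂ y.2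
  tr_nonneg u₁ y := Finset.sum_nonneg fun u₂ _ =>
    mul_nonneg (mul_nonneg (by norm_num) (W₁.tr_nonneg _ _)) (W₂.tr_nonneg _ _)
  tr_sum u₁ := by
    rw [Finset.sum_comm]
    have h : ∀ u₂ : ZMod 2, ∑ y : W₁.Out × W₂.Out,
        (1 / 2 : ℝ) * W₁.tr (u₁ + u₂) y.1 * W₂.tr u₂ y.2 = 1 / 2 := fun u₂ => by
      rw [Fintype.sum_prod_type]
      simp_rw [← Finset.mul_sum, W₂.tr_sum, mul_one, ← Finset.mul_sum, W₁.tr_sum, mul_one]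
    simp_rw [h]
    simp [ZMod.card]

/-- `W⁺(y¹,y²,u¹ | u²) = ½ W¹(y¹ | u¹ ⊕ u²) W²(y² | u²)`. -/
def BDMC.plus (W₁ W₂ : BDMC) : BDMC where
  Out := W₁.Out × W₂.Out × ZMod 2
  fintypeOut := inferInstance
  tr u₂ y := (1 / 2 : ℝ) * W₁.tr (y.2.2 + u₂) y.1 * W₂.tr u₂ y.2.1
  tr_nonneg u₂ y :=
    mul_nonneg (mul_nonneg (by norm_num) (W₁.tr_nonneg _ _)) (W₂.tr_nonneg _ _)
  tr_sum u₂ := by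
    rw [Fintype.sum_prod_type_right, Fintype.sum_prod_type_right]
    simp_rw [← Finset.sum_mul, ← Finset.mul_sum, W₁.tr_sum, mul_one]
    simp [ZMod.card, W₂.tr_sum]

/-- The binary erasure channel with erasure probability `ε`; the output `none` is the letter `?`. -/
def bec (ε : unitInterval) : BDMC where
  Out := Option (ZMod 2)
  fintypeOut := inferInstance
  tr x y := match y with
    | none => (ε : ℝ)
    | some z => if z = x then 1 - (ε : ℝ) else 0
  tr_nonneg x y := by
    cases y with
    | none => exact ε.2.1
    | some z =>
      have := ε.2.2
      dsimp only
      split_ifs <;> linarith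
  tr_sum x := by simp [Fintype.sum_option]

/-- The channel `ρ V₁ + (1-ρ) V₀`, with `V₁` the full-noise and `V₀` the noiseless erasure channel,
whose likelihoods initialise the decoder. -/
def mixedChannel (ρ : unitInterval) : BDMC where
  Out := Option (ZMod 2)
  fintypeOut := inferInstance
  tr x y := (ρ : ℝ) * (bec 1).tr x y + (1 - (ρ : ℝ)) * (bec 0).tr x y
  tr_nonneg x y := add_nonneg (mul_nonneg ρ.2.1 ((bec 1).tr_nonneg x y))
    (mul_nonneg (by have := ρ.2.2; linarith) ((bec 0).tr_nonneg x y))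
  tr_sum x := by
    have h1 := (bec 1).tr_sum x
    have h0 := (bec 0).tr_sum x
    have : ∀ f g : Option (ZMod 2) → ℝ, ∑ y, f y = 1 → ∑ y, g y = 1 →
        ∑ y, ((ρ : ℝ) * f y + (1 - (ρ : ℝ)) * g y) = 1 := fun f g hf hg => by
      rw [Finset.sum_add_distrib, ← Finset.mul_sum, ← Finset.mul_sum, hf, hg]; ring
    exact this _ _ h1 h0

/-! The recursive polarization transformation of a sequence of `N = 2 ^ n` channels.
Positions are numbered `0, …, N - 1`, so that the paired indices `2j - 1, 2j` become
`2j, 2j + 1`. -/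

/-- Position `j` of the first half of a sequence of length `2 ^ (n + 1)`. -/
def fstHalf {n : ℕ} (j : Fin (2 ^ n)) : Fin (2 ^ (n + 1)) :=
  ⟨j, by have := j.2; rw [pow_succ]; omega⟩

/-- Position `j` of the second half of a sequence of length `2 ^ (n + 1)`. -/
def sndHalf {n : ℕ} (j : Fin (2 ^ n)) : Fin (2 ^ (n + 1)) :=
  ⟨2 ^ n + j, by have := j.2; rw [pow_succ]; omega⟩

/-- The position `2 j`. -/
def evenPos {n : ℕ} (j : Fin (2 ^ n)) : Fin (2 ^ (n + 1)) :=
  ⟨2 * j, by have := j.2; rw [pow_succ]; omega⟩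

/-- The position `2 j + 1`. -/
def oddPos {n : ℕ} (j : Fin (2 ^ n)) : Fin (2 ^ (n + 1)) :=
  ⟨2 * j + 1, by have := j.2; rw [pow_succ]; omega⟩

/-- The index `j` with `i = 2 j` or `i = 2 j + 1`. -/
def halfIdx {n : ℕ} (i : Fin (2 ^ (n + 1))) : Fin (2 ^ n) :=
  ⟨i / 2, by have := i.2; have h := pow_succ 2 n; omega⟩

/-- The generated channels `W_N^{(i)}` of a (possibly non-stationary) sequence of channels. -/
def polarize : (n : ℕ) → (Fin (2 ^ n) → BDMC) → Fin (2 ^ n) → BDMC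
  | 0, W, i => W i
  | n + 1, W, i =>
    let A := polarize n (fun j => W (fstHalf j)) (halfIdx i)
    let B := polarize n (fun j => W (sndHalf j)) (halfIdx i)
    if (i : ℕ) % 2 = 0 then A.minus B else A.plus B

/-- A channel together with one of its output letters. -/
structure Received where
  chan : BDMC
  out : chan.Out

/-- The likelihood `W(y | u)` of the input `u`, for the channel `W` and the output `y`. -/
def Received.lik (r : Received) (u : ZMod 2) : ℝ := r.chan.tr u r.out

/-- For the channel outputs `y` and the bits `v`, the channel `W_N^{(i)}` together with its output
letter `(y^{1:N}, v^{1:i-1})`, arranged as in the recursion of `polarize`. Only the bits of `v`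
at positions smaller than `i` enter. -/
def received : (n : ℕ) → (W : Fin (2 ^ n) → BDMC) → (∀ j, (W j).Out) → (Fin (2 ^ n) → ZMod 2) →
    Fin (2 ^ n) → Received
  | 0, W, y, _, i => ⟨W i, y i⟩
  | n + 1, W, y, v, i =>
    let a := received n (fun j => W (fstHalf j)) (fun j => y (fstHalf j))
      (fun j => v (evenPos j) + v (oddPos j)) (halfIdx i)
    let b := received n (fun j => W (sndHalf j)) (fun j => y (sndHalf j))
      (fun j => v (oddPos j)) (halfIdx i)
    if (i : ℕ) % 2 = 0 then ⟨a.chan.minus b.chan, (a.out, b.out)⟩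
    else ⟨a.chan.plus b.chan, (a.out, b.out, v (evenPos (halfIdx i)))⟩

/-- The channel underlying `received` is the generated channel `W_N^{(i)}`. -/
theorem received_chan (n : ℕ) (W : Fin (2 ^ n) → BDMC) (y : ∀ j, (W j).Out)
    (v : Fin (2 ^ n) → ZMod 2) (i : Fin (2 ^ n)) : (received n W y v i).chan = polarize n W i := by
  induction n with
  | zero => rfl
  | succ n ih =>
    simp only [received, polarize]
    split_ifs <;> simp [ih]

/-! The generator matrix `G_N = R F^{⊗ n}`. -/

/-- The kernel matrix `F`. -/
def kernelF : Matrix (Fin 2) (Fin 2) (ZMod 2) := !![1, 0; 1, 1]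

/-- The Kronecker power `F^{⊗ n}`. -/
def kronF : (n : ℕ) → Matrix (Fin (2 ^ n)) (Fin (2 ^ n)) (ZMod 2)
  | 0 => 1
  | n + 1 => Matrix.reindex finProdFinEquiv finProdFinEquiv
      (Matrix.kroneckerMap (· * ·) (kronF n) kernelF)

/-- The bit-reversal permutation matrix `R`. -/
def bitRev (n : ℕ) : Matrix (Fin (2 ^ n)) (Fin (2 ^ n)) (ZMod 2) := fun i j =>
  if ∀ k < n, (i : ℕ).testBit k = (j : ℕ).testBit (n - 1 - k) then 1 else 0

/-- The generator matrix of polar codes of length `2 ^ n`. -/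
def genG (n : ℕ) : Matrix (Fin (2 ^ n)) (Fin (2 ^ n)) (ZMod 2) := bitRev n * kronF n

/-! Equivalent channel blocks and the adversary's choice of the erased positions. -/

/-- The equivalent channel block for the erased set `S`: full-noise erasure channels on `S`,
noiseless ones off `S`. -/
def eqvBlock {n : ℕ} (S : Finset (Fin (2 ^ n))) (i : Fin (2 ^ n)) : BDMC :=
  if i ∈ S then bec 1 else bec 0

/-- `Z(W_{ρ,N}^{(i)})` as a function of the set `S` of erased positions. -/
def Zgen {n : ℕ} (S : Finset (Fin (2 ^ n))) (i : Fin (2 ^ n)) : ℝ :=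
  (polarize n (eqvBlock S) i).Z

/-- The law `ν` under which every position is erased with probability `ρ`, independently of the
others. -/
def IsIndepLaw (ρ : ℝ) {n : ℕ} (ν : PMF (Finset (Fin (2 ^ n)))) : Prop :=
  ∀ S, (ν S).toReal = ρ ^ S.card * (1 - ρ) ^ (2 ^ n - S.card)

/-- The law `ν` of an erased set that is uniformly distributed among the sets of `k` positions, where
`k = ρ N` up to rounding to a neighbouring integer, `N = 2 ^ n` (so `k = ρ N` if `ρ N` is an
integer). -/
def IsFractionLaw (ρ : ℝ) {n : ℕ} (ν : PMF (Finset (Fin (2 ^ n)))) : Prop :=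
  ∃ k : ℕ, k ≤ 2 ^ n ∧ |(k : ℝ) - ρ * 2 ^ n| < 1 ∧
    ∀ S, (ν S).toReal = if S.card = k then 1 / ((2 ^ n).choose k : ℝ) else 0

/-- The laws of a random erased set of fraction `ρ`. -/
def IsErasureLaw (ρ : ℝ) {n : ℕ} (ν : PMF (Finset (Fin (2 ^ n)))) : Prop :=
  IsIndepLaw ρ ν ∨ IsFractionLaw ρ ν

/-- `P(W_{ρ,N}^{(i)}) = Pr{Z(W_{ρ,N}^{(i)}) = 1}` for an erased set of law `ν`. -/
def Pgen {n : ℕ} (ν : PMF (Finset (Fin (2 ^ n)))) (i : Fin (2 ^ n)) : ℝ :=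
  prob ν {S | Zgen S i = 1}

/-- `δ_N = 2 ^ (-N ^ β)` with `N = 2 ^ n`. -/
def delta (β : ℝ) (n : ℕ) : ℝ := (2 : ℝ) ^ (-((2 : ℝ) ^ n) ^ β)

open Classical in
/-- The indices `i` with `P(W_{ρ,N}^{(i)}) ≤ δ_N`. -/
def lowSet (β : ℝ) {n : ℕ} (ν : PMF (Finset (Fin (2 ^ n)))) : Finset (Fin (2 ^ n)) :=
  Finset.univ.filter fun i => Pgen ν i ≤ delta β n

open Classical in
/-- The indices `i` with `P(W_{ρ,N}^{(i)}) ≥ 1 - δ_N`. -/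
def highSet (β : ℝ) {n : ℕ} (ν : PMF (Finset (Fin (2 ^ n)))) : Finset (Fin (2 ^ n)) :=
  Finset.univ.filter fun i => 1 - delta β n ≤ Pgen ν i

/-! The chained scheme. `Lw` is the low set of the writing-equivalent block and `Hr` the high set of
the reading-equivalent block. -/

section Scheme

variable {n : ℕ} (Lw Hr : Finset (Fin (2 ^ n)))

def setI : Finset (Fin (2 ^ n)) := Lw ∩ Hr
def setR : Finset (Fin (2 ^ n)) := Lw ∩ Hrᶜ
def setF : Finset (Fin (2 ^ n)) := Lwᶜ ∩ Hr
def setB : Finset (Fin (2 ^ n)) := Lwᶜ ∩ Hrᶜ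

/-- The free choices in the scheme with `T` blocks: a subset `E ⊆ I` with `|E| = |B|`, the
correspondence between the positions of `B` and those of `E`, and the public frozen bits. -/
structure Scheme (T : ℕ) where
  E : Finset (Fin (2 ^ n))
  E_subset : E ⊆ setI Lw Hr
  link : {i // i ∈ setB Lw Hr} ≃ {i // i ∈ E}
  frozen : Fin T → {i // i ∈ setF Lw Hr} → ZMod 2

variable {Lw Hr} {T : ℕ} (c : Scheme Lw Hr T)

/-- The message: the information bits on `I \ E` of all blocks. -/
abbrev Scheme.Msg : Type := Fin T → {i // i ∈ setI Lw Hr \ c.E} → ZMod 2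

/-- The random bits on `E ∪ R` of all blocks. -/
abbrev Scheme.Rnd : Type := Fin T → {i // i ∈ c.E ∪ setR Lw Hr} → ZMod 2

/-- The pre-shared bits, used on `B` of the first block. -/
abbrev Scheme.Pre (_c : Scheme Lw Hr T) : Type := {i // i ∈ setB Lw Hr} → ZMod 2

/-- All data that enter the encoder. -/
abbrev Scheme.Src : Type := c.Msg × c.Rnd × c.Pre

/-- The law of the encoder's data: a message of law `π`, and independent uniform random bits and
pre-shared bits. -/
def Scheme.srcLaw (π : PMF c.Msg) : PMF c.Src :=
  π.bind fun m => (PMF.uniformOfFintype (c.Rnd × c.Pre)).map fun r => (m, r)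

/-- The vector `u^N` of block `t` (blocks are numbered from `0`). On `B`, every block but the first
repeats the bits that the preceding block carries on `E`. -/
def Scheme.uVec (ω : c.Src) (t : Fin T) (i : Fin (2 ^ n)) : ZMod 2 :=
  if hI : i ∈ setI Lw Hr \ c.E then ω.1 t ⟨i, hI⟩
  else if hR : i ∈ c.E ∪ setR Lw Hr then ω.2.1 t ⟨i, hR⟩
  else if hF : i ∈ setF Lw Hr then c.frozen t ⟨i, hF⟩
  else if hB : i ∈ setB Lw Hr then
    if (t : ℕ) = 0 then ω.2.2 ⟨i, hB⟩
    else ω.2.1 ⟨t - 1, lt_of_le_of_lt (Nat.sub_le _ _) t.2⟩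
      ⟨c.link ⟨i, hB⟩, Finset.mem_union_left _ (c.link ⟨i, hB⟩).2⟩
  else 0

/-- The channel input `x^N = u^N G_N` of block `t`. -/
def Scheme.xVec (ω : c.Src) (t : Fin T) : Fin (2 ^ n) → ZMod 2 :=
  Matrix.vecMul (c.uVec ω t) (genG n)

/-- The received word of block `t`, when the adversary writes `?` on the positions `S t`. -/
def Scheme.yVec (S : Fin T → Finset (Fin (2 ^ n))) (ω : c.Src) (t : Fin T) (j : Fin (2 ^ n)) :
    Option (ZMod 2) :=
  if j ∈ S t then none else some (c.xVec ω t j)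

/-- A decoder maps the received words and the pre-shared bits to the estimates of all `u^N`. -/
abbrev Scheme.Decoder : Type :=
  (Fin T → Fin (2 ^ n) → Option (ZMod 2)) → c.Pre → Fin T → Fin (2 ^ n) → ZMod 2

/-- Successive cancellation decoding with initial channel `ρ V₁ + (1-ρ) V₀`; ties in the arg max
may be broken in any way. -/
def Scheme.IsSC (ρ : unitInterval) (D : c.Decoder) : Prop :=
  ∀ y b t i,
    (i ∈ setI Lw Hr ∪ setR Lw Hr → ∀ u : ZMod 2,
      (received n (fun _ => mixedChannel ρ) (y t) (D y b t) i).lik u ≤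
        (received n (fun _ => mixedChannel ρ) (y t) (D y b t) i).lik (D y b t i)) ∧
    (∀ h : i ∈ setF Lw Hr, D y b t i = c.frozen t ⟨i, h⟩) ∧
    (∀ h : i ∈ setB Lw Hr, (t : ℕ) = 0 → D y b t i = b ⟨i, h⟩) ∧
    (∀ h : i ∈ setB Lw Hr, ∀ t' : Fin T, (t' : ℕ) + 1 = t →
      D y b t i = D y b t' (c.link ⟨i, h⟩))

/-- The `T`-block error probability, for given written sets: the probability that some bit of some
`u^N` is decoded incorrectly. -/
def Scheme.blockErr (D : c.Decoder) (π : PMF c.Msg) (S : Fin T → Finset (Fin (2 ^ n))) : ℝ :=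
  prob (c.srcLaw π) {ω | ∃ t i, D (c.yVec S ω) ω.2.2 t i ≠ c.uVec ω t i}

/-- The probability `Pr(M̂ ≠ M)` of an error in the message, for given written sets. -/
def Scheme.msgErr (D : c.Decoder) (π : PMF c.Msg) (S : Fin T → Finset (Fin (2 ^ n))) : ℝ :=
  prob (c.srcLaw π)
    {ω | (fun t (i : {i // i ∈ setI Lw Hr \ c.E}) => D (c.yVec S ω) ω.2.2 t i) ≠ ω.1}

/-- The sum of `Z(W_{ρ_w,N}^{(i)})` over `i ∈ I ∪ R` in all `T` blocks and over `i ∈ E` in the first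
`T - 1` blocks. -/
def Scheme.bound (S : Fin T → Finset (Fin (2 ^ n))) : ℝ :=
  ∑ t, ∑ i ∈ setI Lw Hr ∪ setR Lw Hr, Zgen (S t) i +
    ∑ t ∈ Finset.univ.filter (fun t : Fin T => (t : ℕ) + 1 < T), ∑ i ∈ c.E, Zgen (S t) i

end Scheme

end AWTC

end

noncomputable section

namespace AWTC

/-! Entries of the generator matrix. -/

/-! For a fixed erased set, polarization is deterministic: each generated channel is either useless,
with Z = 1, or noiseless, with Z = 0 (`Zgen_eq`). The error bound is therefore a sum of zeros and
ones. If it is nonzero it is at least 1 and there is nothing to prove. If it is 0, all indices of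
`Lw` are noiseless, and successive cancellation makes no error at all (`Scheme.IsSC.decode_eq`): the
true bit has positive likelihood and the flipped bit has likelihood 0, even though the decoder uses
the mixed channel, because only the zero pattern of the likelihoods matters (`lik_received`). This
needs the matrix encoder to obey the same recursion as the channels.

For random sets, a union bound over blocks and low indices controls the probability that the bound
is nonzero; it involves only the marginal law of each set. If the low indices come from independent
erasures and the actual set has a fixed size k, conditioning on size k costs a factor polynomial in
N, since k is next to the mean of the binomial law (`exists_binomWeight_lower_bound`). The decay of
`delta` beats every power of N. -/

theorem sum_even_odd {M : Type*} [AddCommMonoid M] {n : ℕ} (f : Fin (2 ^ (n + 1)) → M) :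
    ∑ i, f i = ∑ j : Fin (2 ^ n), (f (evenPos j) + f (oddPos j)) := by
  have h : ∑ p : Fin (2 ^ n) × Fin 2, f (finProdFinEquiv p : Fin (2 ^ n * 2)) = ∑ i, f i :=
    Fintype.sum_equiv (finProdFinEquiv : Fin (2 ^ n) × Fin 2 ≃ Fin (2 ^ n * 2)) _ _ fun _ => rfl
  rw [← h, Fintype.sum_prod_type]
  refine Finset.sum_congr rfl fun j _ => ?_
  rw [Fin.sum_univ_two]
  congr 2 <;> apply Fin.ext <;> simp [evenPos, oddPos, finProdFinEquiv, add_comm]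

theorem kronF_succ (n : ℕ) (i j : Fin (2 ^ (n + 1))) :
    kronF (n + 1) i j = kronF n (halfIdx i) (halfIdx j) *
      kernelF ⟨i % 2, Nat.mod_lt _ two_pos⟩ ⟨j % 2, Nat.mod_lt _ two_pos⟩ := rfl

theorem kernelF_apply (a b : Fin 2) :
    kernelF a b = if (b : ℕ) = 1 → (a : ℕ) = 1 then 1 else 0 := by
  fin_cases a <;> fin_cases b <;> simp [kernelF]

/-- The entry is the product of the kernel entries over the binary digits, and `kernelF` vanishes
only in row 0, column 1. -/
theorem kronF_apply (n : ℕ) (i j : Fin (2 ^ n)) :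
    kronF n i j = if ∀ k < n, (j : ℕ).testBit k → (i : ℕ).testBit k then 1 else 0 := by
  induction n with
  | zero =>
    rw [if_pos fun k hk => absurd hk (Nat.not_lt_zero k), Subsingleton.elim (α := Fin 1) i j]
    exact Matrix.one_apply_eq j
  | succ n ih =>
    rw [kronF_succ, ih, kernelF_apply, ite_zero_mul_ite_zero, one_mul]
    congr 1
    simp only [eq_iff_iff, Nat.forall_lt_succ_left, Nat.testBit_succ, halfIdx, Nat.testBit_zero,
      decide_eq_true_eq]
    tauto

/-- Locates the only nonzero entry in row `i` of `bitRev n`. -/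
theorem exists_testBit_rev {n : ℕ} (i : Fin (2 ^ n)) :
    ∃ l : Fin (2 ^ n), ∀ k < n, (i : ℕ).testBit k = (l : ℕ).testBit (n - 1 - k) := by
  refine ⟨⟨Nat.ofBits fun k : Fin n => (i : ℕ).testBit (n - 1 - k), Nat.ofBits_lt_two_pow _⟩, ?_⟩
  intro k hk
  rw [Nat.testBit_ofBits_lt _ _ (by omega)]
  congr 1
  dsimp only
  omega

theorem genG_apply (n : ℕ) (i j : Fin (2 ^ n)) :
    genG n i j = if ∀ k < n, (j : ℕ).testBit k → (i : ℕ).testBit (n - 1 - k) then 1 else 0 := by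
  obtain ⟨l, hl⟩ := exists_testBit_rev i
  have hrev : ∀ k < n, (l : ℕ).testBit k = (i : ℕ).testBit (n - 1 - k) := fun k hk => by
    rw [hl (n - 1 - k) (by omega)]
    congr 1
    omega
  rw [genG, Matrix.mul_apply, Finset.sum_eq_single l]
  · rw [bitRev, if_pos hl, one_mul, kronF_apply]
    congr 1
    exact propext (forall₂_congr fun k hk => by rw [hrev k hk])
  · intro m _ hm
    rw [bitRev, if_neg, zero_mul]
    intro h
    refine hm (Fin.ext (Nat.eq_of_testBit_eq fun k => ?_))
    by_cases hk : k < n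
    · rw [hrev k hk, h (n - 1 - k) (by omega)]
      congr 1
      omega
    · have hp : 2 ^ n ≤ 2 ^ k := Nat.pow_le_pow_right two_pos (not_lt.mp hk)
      rw [Nat.testBit_lt_two_pow (m.2.trans_le hp), Nat.testBit_lt_two_pow (l.2.trans_le hp)]
  · simp

/-- Bit reversal pairs the lowest bit of the row with the highest bit of the column. Sorted by row
parity and column half, the generator matrix thus has the block pattern of `kernelF`; this lemma and
the next three treat the four blocks. -/
theorem genG_succ_even_fst {n : ℕ} (i j : Fin (2 ^ n)) :
    genG (n + 1) (evenPos i) (fstHalf j) = genG n i j := by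
  rw [genG_apply, genG_apply]
  congr 1
  refine propext ⟨fun h k hk hb => ?_, fun h k hk hb => ?_⟩
  · have := h k (by omega) hb
    rw [show n + 1 - 1 - k = (n - 1 - k) + 1 by omega, Nat.testBit_succ] at this
    simpa [evenPos] using this
  · rcases Nat.lt_succ_iff_lt_or_eq.mp hk with hk | rfl
    · have := h k hk hb
      rw [show n + 1 - 1 - k = (n - 1 - k) + 1 by omega, Nat.testBit_succ]
      simpa [evenPos] using this
    · simp [fstHalf, Nat.testBit_lt_two_pow j.2] at hb

theorem genG_succ_odd_fst {n : ℕ} (i j : Fin (2 ^ n)) :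
    genG (n + 1) (oddPos i) (fstHalf j) = genG n i j := by
  rw [genG_apply, genG_apply]
  congr 1
  have hd : (2 * (i : ℕ) + 1) / 2 = i := by omega
  refine propext ⟨fun h k hk hb => ?_, fun h k hk hb => ?_⟩
  · have := h k (by omega) hb
    rw [show n + 1 - 1 - k = (n - 1 - k) + 1 by omega, Nat.testBit_succ] at this
    simpa [oddPos, hd] using this
  · rcases Nat.lt_succ_iff_lt_or_eq.mp hk with hk | rfl
    · have := h k hk hb
      rw [show n + 1 - 1 - k = (n - 1 - k) + 1 by omega, Nat.testBit_succ]
      simpa [oddPos, hd] using this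
    · simp [fstHalf, Nat.testBit_lt_two_pow j.2] at hb

theorem genG_succ_even_snd {n : ℕ} (i j : Fin (2 ^ n)) :
    genG (n + 1) (evenPos i) (sndHalf j) = 0 := by
  rw [genG_apply, if_neg]
  intro h
  have := h n (by omega) (by simp [sndHalf, Nat.testBit_two_pow_add_eq, Nat.testBit_lt_two_pow j.2])
  simp [evenPos] at this

theorem genG_succ_odd_snd {n : ℕ} (i j : Fin (2 ^ n)) :
    genG (n + 1) (oddPos i) (sndHalf j) = genG n i j := by
  rw [genG_apply, genG_apply]
  congr 1
  have hd : (2 * (i : ℕ) + 1) / 2 = i := by omega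
  have hs : ∀ k < n, (sndHalf j : ℕ).testBit k = (j : ℕ).testBit k := fun k hk => by
    simp [sndHalf, Nat.testBit_two_pow_add_gt hk]
  refine propext ⟨fun h k hk hb => ?_, fun h k hk hb => ?_⟩
  · have := h k (by omega) (by rwa [hs k hk])
    rw [show n + 1 - 1 - k = (n - 1 - k) + 1 by omega, Nat.testBit_succ] at this
    simpa [oddPos, hd] using this
  · rcases Nat.lt_succ_iff_lt_or_eq.mp hk with hk | rfl
    · have := h k hk (by rwa [hs k hk] at hb)
      rw [show n + 1 - 1 - k = (n - 1 - k) + 1 by omega, Nat.testBit_succ]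
      simpa [oddPos, hd] using this
    · simp [oddPos]

theorem vecMul_genG_fstHalf {n : ℕ} (v : Fin (2 ^ (n + 1)) → ZMod 2) (j : Fin (2 ^ n)) :
    Matrix.vecMul v (genG (n + 1)) (fstHalf j) =
      Matrix.vecMul (fun j => v (evenPos j) + v (oddPos j)) (genG n) j := by
  simp only [Matrix.vecMul, dotProduct, sum_even_odd, genG_succ_even_fst, genG_succ_odd_fst,
    add_mul]

theorem vecMul_genG_sndHalf {n : ℕ} (v : Fin (2 ^ (n + 1)) → ZMod 2) (j : Fin (2 ^ n)) :
    Matrix.vecMul v (genG (n + 1)) (sndHalf j) =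
      Matrix.vecMul (fun j => v (oddPos j)) (genG n) j := by
  simp only [Matrix.vecMul, dotProduct, sum_even_odd, genG_succ_even_snd, genG_succ_odd_snd,
    mul_zero, zero_add]

theorem vecMul_genG_zero (v : Fin (2 ^ 0) → ZMod 2) (j : Fin (2 ^ 0)) :
    Matrix.vecMul v (genG 0) j = v j := by
  have h : ∀ i, genG 0 i j = 1 := fun i => by rw [genG_apply]; simp
  simp only [Matrix.vecMul, dotProduct, h, mul_one]
  exact Fintype.sum_eq_single j fun i hi => absurd (Subsingleton.elim (α := Fin 1) i j) hi

/-! Erasures under the polarization recursion. -/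

/-- The generated channel with index `i` is noisy, when the initial channels with `e j` are useless
and the others are noiseless. -/
def erased : (n : ℕ) → (Fin (2 ^ n) → Prop) → Fin (2 ^ n) → Prop
  | 0, e, i => e i
  | n + 1, e, i =>
    if (i : ℕ) % 2 = 0 then
      erased n (fun j => e (fstHalf j)) (halfIdx i) ∨ erased n (fun j => e (sndHalf j)) (halfIdx i)
    else
      erased n (fun j => e (fstHalf j)) (halfIdx i) ∧ erased n (fun j => e (sndHalf j)) (halfIdx i)

/-- Every output excludes one of the two inputs; `x + 1` is the input other than `x`. -/
def BDMC.IsNoiseless (W : BDMC) : Prop := ∀ y x, W.tr x y * W.tr (x + 1) y = 0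

def BDMC.IsUseless (W : BDMC) : Prop := ∀ y x x', W.tr x y = W.tr x' y

theorem sum_zmod_two {M : Type*} [AddCommMonoid M] (f : ZMod 2 → M) (x : ZMod 2) :
    ∑ u, f u = f x + f (x + 1) := by
  have h : ∑ u, f u = f 0 + f 1 := Fin.sum_univ_two f
  fin_cases x
  · exact h
  · exact h.trans (add_comm _ _)

theorem zmod_two_eq_or (x y : ZMod 2) : y = x ∨ y = x + 1 := by decide +revert

theorem zmod_two_add_self (x : ZMod 2) : x + x = 0 := by decide +revert

theorem BDMC.IsNoiseless.Z_eq {W : BDMC} (h : W.IsNoiseless) : W.Z = 0 :=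
  Finset.sum_eq_zero fun y _ => by
    have := h y 0
    rw [zero_add] at this
    rw [this, Real.sqrt_zero]

theorem BDMC.IsUseless.Z_eq {W : BDMC} (h : W.IsUseless) : W.Z = 1 := by
  rw [← W.tr_sum 0]
  exact Finset.sum_congr rfl fun y _ => by rw [h y 1 0, Real.sqrt_mul_self (W.tr_nonneg _ _)]

theorem BDMC.IsUseless.minus_left {A B : BDMC} (h : A.IsUseless) : (A.minus B).IsUseless := by
  intro y x x'
  change ∑ u : ZMod 2, (1 / 2 : ℝ) * A.tr (x + u) y.1 * B.tr u y.2 =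
    ∑ u : ZMod 2, (1 / 2 : ℝ) * A.tr (x' + u) y.1 * B.tr u y.2
  exact Finset.sum_congr rfl fun u _ => by rw [h y.1 (x + u) (x' + u)]

/-- With the second factor constant, the sum over the hidden bit runs through both inputs of `A`,
whatever `x` is. -/
theorem BDMC.IsUseless.minus_right {A B : BDMC} (h : B.IsUseless) : (A.minus B).IsUseless := by
  intro y x x'
  have key : ∀ x, (A.minus B).tr x y = 1 / 2 * (A.tr 0 y.1 + A.tr (0 + 1) y.1) * B.tr 0 y.2 := by
    intro x
    change ∑ u : ZMod 2, (1 / 2 : ℝ) * A.tr (x + u) y.1 * B.tr u y.2 = _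
    rw [sum_zmod_two _ x, h y.2 x 0, h y.2 (x + 1) 0, ← add_assoc, zmod_two_add_self]
    ring
  rw [key, key]

theorem BDMC.IsNoiseless.minus {A B : BDMC} (hA : A.IsNoiseless) (hB : B.IsNoiseless) :
    (A.minus B).IsNoiseless := by
  intro y x
  change (∑ u : ZMod 2, (1 / 2 : ℝ) * A.tr (x + u) y.1 * B.tr u y.2) *
    (∑ u : ZMod 2, (1 / 2 : ℝ) * A.tr (x + 1 + u) y.1 * B.tr u y.2) = 0
  have hA := hA y.1 x
  have hB := hB y.2 0
  rw [sum_zmod_two _ 0, sum_zmod_two _ 0]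
  simp only [add_zero, zero_add, add_assoc, zmod_two_add_self] at *
  -- Each of the four products contains both likelihoods of `A` or both likelihoods of `B`.
  linear_combination (1 / 4 * B.tr 0 y.2 ^ 2 + 1 / 4 * B.tr 1 y.2 ^ 2) * hA +
    (1 / 4 * A.tr x y.1 ^ 2 + 1 / 4 * A.tr (x + 1) y.1 ^ 2) * hB

theorem BDMC.IsUseless.plus {A B : BDMC} (hA : A.IsUseless) (hB : B.IsUseless) :
    (A.plus B).IsUseless := by
  intro y x x'
  change (1 / 2 : ℝ) * A.tr (y.2.2 + x) y.1 * B.tr x y.2.1 =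
    (1 / 2 : ℝ) * A.tr (y.2.2 + x') y.1 * B.tr x' y.2.1
  rw [hA y.1 (y.2.2 + x) (y.2.2 + x'), hB y.2.1 x x']

theorem BDMC.IsNoiseless.plus_left {A B : BDMC} (h : A.IsNoiseless) : (A.plus B).IsNoiseless := by
  intro y x
  change (1 / 2 : ℝ) * A.tr (y.2.2 + x) y.1 * B.tr x y.2.1 *
    ((1 / 2 : ℝ) * A.tr (y.2.2 + (x + 1)) y.1 * B.tr (x + 1) y.2.1) = 0
  rw [← add_assoc]
  linear_combination (1 / 4 * B.tr x y.2.1 * B.tr (x + 1) y.2.1) * h y.1 (y.2.2 + x)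

theorem BDMC.IsNoiseless.plus_right {A B : BDMC} (h : B.IsNoiseless) : (A.plus B).IsNoiseless := by
  intro y x
  change (1 / 2 : ℝ) * A.tr (y.2.2 + x) y.1 * B.tr x y.2.1 *
    ((1 / 2 : ℝ) * A.tr (y.2.2 + (x + 1)) y.1 * B.tr (x + 1) y.2.1) = 0
  linear_combination
    (1 / 4 * A.tr (y.2.2 + x) y.1 * A.tr (y.2.2 + (x + 1)) y.1) * h y.2.1 x

/-- The minus channel is useless as soon as one factor is, the plus channel noiseless as soon as one
factor is. So the two extreme types are closed under the recursion, which acts on them as "or" and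
"and". -/
theorem polarize_isUseless_and_isNoiseless (n : ℕ) (e : Fin (2 ^ n) → Prop)
    (W : Fin (2 ^ n) → BDMC) (h1 : ∀ j, e j → (W j).IsUseless)
    (h0 : ∀ j, ¬ e j → (W j).IsNoiseless) (i : Fin (2 ^ n)) :
    (erased n e i → (polarize n W i).IsUseless) ∧
      (¬ erased n e i → (polarize n W i).IsNoiseless) := by
  induction n with
  | zero => exact ⟨h1 i, h0 i⟩
  | succ n ih =>
    obtain ⟨a1, a0⟩ := ih (fun j => e (fstHalf j)) (fun j => W (fstHalf j)) (fun j => h1 _)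
      (fun j => h0 _) (halfIdx i)
    obtain ⟨b1, b0⟩ := ih (fun j => e (sndHalf j)) (fun j => W (sndHalf j)) (fun j => h1 _)
      (fun j => h0 _) (halfIdx i)
    simp only [erased, polarize]
    split_ifs with hi
    · refine ⟨?_, fun h => ?_⟩
      · rintro (h | h)
        · exact (a1 h).minus_left
        · exact (b1 h).minus_right
      · rw [not_or] at h
        exact (a0 h.1).minus (b0 h.2)
    · refine ⟨fun h => (a1 h.1).plus (b1 h.2), fun h => ?_⟩
      rcases not_and_or.mp h with h | h
      · exact (a0 h).plus_left
      · exact (b0 h).plus_right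

theorem isUseless_bec_one : (bec 1).IsUseless := by
  intro y x x'
  cases y <;> simp [bec]

theorem isNoiseless_bec_zero : (bec 0).IsNoiseless := by
  intro y x
  cases y with
  | none => simp [bec]
  | some z =>
    have hx : ¬ x = x + 1 := by decide +revert
    by_cases hz : z = x
    · subst hz
      simp [bec, hx]
    · simp [bec, hz]

theorem Zgen_eq {n : ℕ} (S : Finset (Fin (2 ^ n))) (i : Fin (2 ^ n)) :
    (erased n (· ∈ S) i → Zgen S i = 1) ∧ (¬ erased n (· ∈ S) i → Zgen S i = 0) := by
  have h := polarize_isUseless_and_isNoiseless n (· ∈ S) (eqvBlock S)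
    (fun j hj => by simpa only [eqvBlock, if_pos hj] using isUseless_bec_one)
    (fun j hj => by simpa only [eqvBlock, if_neg hj] using isNoiseless_bec_zero) i
  exact ⟨fun he => (h.1 he).Z_eq, fun he => (h.2 he).Z_eq⟩

theorem Zgen_eq_zero_or_one {n : ℕ} (S : Finset (Fin (2 ^ n))) (i : Fin (2 ^ n)) :
    Zgen S i = 0 ∨ Zgen S i = 1 := by
  by_cases h : erased n (· ∈ S) i
  · exact Or.inr ((Zgen_eq S i).1 h)
  · exact Or.inl ((Zgen_eq S i).2 h)

theorem Zgen_nonneg {n : ℕ} (S : Finset (Fin (2 ^ n))) (i : Fin (2 ^ n)) : 0 ≤ Zgen S i := by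
  rcases Zgen_eq_zero_or_one S i with h | h <;> simp [h]

theorem not_erased_of_Zgen_eq_zero {n : ℕ} {S : Finset (Fin (2 ^ n))} {i : Fin (2 ^ n)}
    (h : Zgen S i = 0) : ¬ erased n (· ∈ S) i := fun he => by
  rw [(Zgen_eq S i).1 he] at h
  exact one_ne_zero h

/-! Likelihoods in successive cancellation decoding. -/

theorem received_congr (n : ℕ) (W : Fin (2 ^ n) → BDMC) (y : ∀ j, (W j).Out)
    (v v' : Fin (2 ^ n) → ZMod 2) (i : Fin (2 ^ n)) (h : ∀ j < i, v j = v' j) :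
    received n W y v i = received n W y v' i := by
  induction n with
  | zero => rfl
  | succ n ih =>
    have he : ∀ j < halfIdx i, v (evenPos j) = v' (evenPos j) := fun j hj => h _ (by
      simp only [Fin.lt_def, halfIdx, evenPos] at *; omega)
    have ho : ∀ j < halfIdx i, v (oddPos j) = v' (oddPos j) := fun j hj => h _ (by
      simp only [Fin.lt_def, halfIdx, oddPos] at *; omega)
    have ha := ih (fun j => W (fstHalf j)) (fun j => y (fstHalf j))
      (fun j => v (evenPos j) + v (oddPos j)) (fun j => v' (evenPos j) + v' (oddPos j)) (halfIdx i)
      (fun j hj => by rw [he j hj, ho j hj])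
    have hb := ih (fun j => W (sndHalf j)) (fun j => y (sndHalf j))
      (fun j => v (oddPos j)) (fun j => v' (oddPos j)) (halfIdx i) ho
    simp only [received]
    rw [ha, hb]
    split_ifs with hi
    · rfl
    -- For odd `i` the remaining bit sits at position `i - 1`.
    · rw [h (evenPos (halfIdx i)) (by simp only [Fin.lt_def, halfIdx, evenPos]; omega)]

/-- Only the supports of the initial likelihoods enter, so `W` may differ from the channel that
produced `y`. The encoder recursion hands the hypotheses down to both halves. -/
theorem lik_received (n : ℕ) (e : Fin (2 ^ n) → Prop) (W : Fin (2 ^ n) → BDMC)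
    (y : ∀ j, (W j).Out) (v : Fin (2 ^ n) → ZMod 2)
    (hpos : ∀ j, 0 < (W j).tr (Matrix.vecMul v (genG n) j) (y j))
    (hzero : ∀ j, ¬ e j → (W j).tr (Matrix.vecMul v (genG n) j + 1) (y j) = 0)
    (i : Fin (2 ^ n)) :
    0 < (received n W y v i).lik (v i) ∧
      (¬ erased n e i → (received n W y v i).lik (v i + 1) = 0) := by
  induction n with
  | zero =>
    have h1 := hpos i
    have h2 := hzero i
    rw [vecMul_genG_zero] at h1 h2
    exact ⟨h1, h2⟩
  | succ n ih =>
    obtain ⟨a1, a0⟩ := ih (fun j => e (fstHalf j)) (fun j => W (fstHalf j))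
      (fun j => y (fstHalf j)) (fun j => v (evenPos j) + v (oddPos j))
      (fun j => by simpa only [vecMul_genG_fstHalf] using hpos (fstHalf j))
      (fun j => by simpa only [vecMul_genG_fstHalf] using hzero (fstHalf j)) (halfIdx i)
    obtain ⟨b1, b0⟩ := ih (fun j => e (sndHalf j)) (fun j => W (sndHalf j))
      (fun j => y (sndHalf j)) (fun j => v (oddPos j))
      (fun j => by simpa only [vecMul_genG_sndHalf] using hpos (sndHalf j))
      (fun j => by simpa only [vecMul_genG_sndHalf] using hzero (sndHalf j)) (halfIdx i)
    simp only [erased, received]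
    generalize received n (fun j => W (fstHalf j)) (fun j => y (fstHalf j))
      (fun j => v (evenPos j) + v (oddPos j)) (halfIdx i) = a at *
    generalize received n (fun j => W (sndHalf j)) (fun j => y (sndHalf j))
      (fun j => v (oddPos j)) (halfIdx i) = b at *
    split_ifs with hi
    · have hv : v i = v (evenPos (halfIdx i)) := congrArg v (Fin.ext (by
        simp only [halfIdx, evenPos]; omega))
      rw [← hv] at a1 a0
      set w := v (oddPos (halfIdx i))
      have hm : ∀ x, (Received.mk (a.chan.minus b.chan) (a.out, b.out)).lik x =
          1 / 2 * a.lik (x + w) * b.lik w + 1 / 2 * a.lik (x + (w + 1)) * b.lik (w + 1) :=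
        fun x => sum_zmod_two
          (fun u => (1 / 2 : ℝ) * a.chan.tr (x + u) a.out * b.chan.tr u b.out) w
      refine ⟨?_, fun h => ?_⟩
      · rw [hm]
        have h1 : 0 ≤ a.lik (v i + (w + 1)) := a.chan.tr_nonneg _ _
        have h2 : 0 ≤ b.lik (w + 1) := b.chan.tr_nonneg _ _
        positivity
      · rw [not_or] at h
        have h1 := a0 h.1
        -- One summand has the flipped input of `a`, the other the flipped input of `b`; both are
        -- noiseless here.
        rw [hm, show v i + 1 + w = v i + w + 1 by ring, h1, b0 h.2]
        ring
    · have hv : v i = v (oddPos (halfIdx i)) := congrArg v (Fin.ext (by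
        simp only [halfIdx, oddPos]; omega))
      rw [← hv] at a1 a0 b1 b0
      set w := v (evenPos (halfIdx i))
      have hp : ∀ x, (Received.mk (a.chan.plus b.chan) (a.out, b.out, w)).lik x =
          1 / 2 * a.lik (w + x) * b.lik x := fun x => rfl
      refine ⟨by rw [hp]; positivity, fun h => ?_⟩
      rw [hp, ← add_assoc]
      rcases not_and_or.mp h with h | h
      · rw [a0 h]; ring
      · rw [b0 h]; ring

/-! Probabilities of events. -/

theorem prob_nonneg {α : Type} (μ : PMF α) (A : Set α) : 0 ≤ prob μ A := ENNReal.toReal_nonneg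

theorem toOuterMeasure_le_one {α : Type} (μ : PMF α) (A : Set α) : μ.toOuterMeasure A ≤ 1 :=
  (MeasureTheory.measure_mono (Set.subset_univ A)).trans_eq
    ((μ.toOuterMeasure_apply_eq_one_iff Set.univ).mpr (Set.subset_univ _))

theorem toOuterMeasure_ne_top {α : Type} (μ : PMF α) (A : Set α) : μ.toOuterMeasure A ≠ ⊤ :=
  ((toOuterMeasure_le_one μ A).trans_lt ENNReal.one_lt_top).ne

theorem prob_le_one {α : Type} (μ : PMF α) (A : Set α) : prob μ A ≤ 1 :=
  ENNReal.toReal_le_of_le_ofReal zero_le_one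
    (by simpa using toOuterMeasure_le_one μ A)

theorem prob_mono_on_support {α : Type} (μ : PMF α) {A B : Set α}
    (h : ∀ x ∈ A, x ∈ μ.support → x ∈ B) : prob μ A ≤ prob μ B :=
  ENNReal.toReal_mono (toOuterMeasure_ne_top μ B)
    (PMF.toOuterMeasure_mono μ fun x hx => h x hx.1 hx.2)

theorem prob_mono {α : Type} (μ : PMF α) {A B : Set α} (h : A ⊆ B) : prob μ A ≤ prob μ B :=
  prob_mono_on_support μ fun _ hx _ => h hx

theorem prob_eq_sum {α : Type} [Fintype α] (μ : PMF α) (A : Set α) :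
    prob μ A = ∑ x, A.indicator (fun x => (μ x).toReal) x := by
  rw [prob, PMF.toOuterMeasure_apply_fintype, ENNReal.toReal_sum]
  · refine Finset.sum_congr rfl fun x _ => ?_
    by_cases hx : x ∈ A <;> simp [hx]
  · intro x _
    by_cases hx : x ∈ A <;> simp [hx, μ.apply_ne_top]

theorem prob_compl {α : Type} (μ : PMF α) (A : Set α) : prob μ Aᶜ = 1 - prob μ A := by
  let _ : MeasurableSpace α := ⊤
  have h : ∀ B : Set α, prob μ B = μ.toMeasure.real B := fun B => by
    rw [prob, MeasureTheory.measureReal_def,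
      PMF.toMeasure_apply_eq_toOuterMeasure_apply _ (MeasurableSpace.measurableSet_top)]
  rw [h, h, MeasureTheory.probReal_compl_eq_one_sub MeasurableSpace.measurableSet_top]

theorem prob_biUnion_le {α ι : Type} (μ : PMF α) (s : Finset ι) (A : ι → Set α) :
    prob μ (⋃ i ∈ s, A i) ≤ ∑ i ∈ s, prob μ (A i) := by
  unfold prob
  rw [← ENNReal.toReal_sum fun i _ => toOuterMeasure_ne_top μ _]
  exact ENNReal.toReal_mono (ENNReal.sum_ne_top.mpr fun i _ => toOuterMeasure_ne_top μ _)
    (MeasureTheory.measure_biUnion_finset_le s A)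

theorem prob_preimage {α γ : Type} (μ : PMF α) (f : α → γ) (A : Set γ) :
    prob μ (f ⁻¹' A) = prob (μ.map f) A := by
  rw [prob, prob, PMF.toOuterMeasure_map_apply]

/-! Correctness of successive cancellation decoding. -/

/-- For `ρ = 0` both laws give only the empty set. This excludes the case in which an erasure occurs
but has likelihood 0 under the decoder's mixed channel. -/
theorem IsErasureLaw.pos_of_mem_support {ρ : ℝ} (h0 : 0 ≤ ρ) {n : ℕ}
    {ν : PMF (Finset (Fin (2 ^ n)))} (hν : IsErasureLaw ρ ν) {S : Finset (Fin (2 ^ n))}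
    (hS : S ∈ ν.support) {j : Fin (2 ^ n)} (hj : j ∈ S) : 0 < ρ := by
  have hne : (ν S).toReal ≠ 0 :=
    ENNReal.toReal_ne_zero.mpr ⟨(PMF.mem_support_iff ν S).mp hS, ν.apply_ne_top S⟩
  have hc : S.card ≠ 0 := Finset.card_ne_zero_of_mem hj
  refine h0.lt_of_ne' fun hρ => ?_
  subst hρ
  rcases hν with hν | ⟨k, -, hk, hν⟩
  · rw [hν S, zero_pow hc, zero_mul] at hne
    exact hne rfl
  · rw [hν S] at hne
    split_ifs at hne with hSk
    · rw [zero_mul, sub_zero, abs_of_nonneg (Nat.cast_nonneg k)] at hk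
      have : k < 1 := by exact_mod_cast hk
      omega
    · exact hne rfl

section Scheme

variable {n : ℕ} {Lw Hr : Finset (Fin (2 ^ n))} {T : ℕ} (c : Scheme Lw Hr T)

theorem setI_union_setR : setI Lw Hr ∪ setR Lw Hr = Lw := by
  rw [setI, setR, ← Finset.inter_union_distrib_left, Finset.union_compl, Finset.inter_univ]

theorem Scheme.E_subset_low : c.E ⊆ Lw := fun _ hi => (Finset.mem_inter.mp (c.E_subset hi)).1

theorem Scheme.uVec_of_mem_setF (ω : c.Src) (t : Fin T) {i : Fin (2 ^ n)} (h : i ∈ setF Lw Hr) :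
    c.uVec ω t i = c.frozen t ⟨i, h⟩ := by
  have hL : i ∉ Lw := Finset.mem_compl.mp (Finset.mem_inter.mp h).1
  have h1 : i ∉ setI Lw Hr \ c.E := fun h => hL (Finset.mem_inter.mp (Finset.mem_sdiff.mp h).1).1
  have h2 : i ∉ c.E ∪ setR Lw Hr := fun h => (Finset.mem_union.mp h).elim
    (fun h => hL (c.E_subset_low h)) (fun h => hL (Finset.mem_inter.mp h).1)
  rw [Scheme.uVec, dif_neg h1, dif_neg h2, dif_pos h]

theorem Scheme.uVec_of_mem_E (ω : c.Src) (t : Fin T) {i : Fin (2 ^ n)} (h : i ∈ c.E) :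
    c.uVec ω t i = ω.2.1 t ⟨i, Finset.mem_union_left _ h⟩ := by
  rw [Scheme.uVec, dif_neg fun h' => (Finset.mem_sdiff.mp h').2 h,
    dif_pos (Finset.mem_union_left _ h)]

theorem Scheme.uVec_of_mem_setB (ω : c.Src) (t : Fin T) {i : Fin (2 ^ n)} (h : i ∈ setB Lw Hr) :
    c.uVec ω t i = if (t : ℕ) = 0 then ω.2.2 ⟨i, h⟩
      else c.uVec ω ⟨t - 1, lt_of_le_of_lt (Nat.sub_le _ _) t.2⟩ (c.link ⟨i, h⟩) := by
  have hL : i ∉ Lw := Finset.mem_compl.mp (Finset.mem_inter.mp h).1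
  have h1 : i ∉ setI Lw Hr \ c.E := fun h => hL (Finset.mem_inter.mp (Finset.mem_sdiff.mp h).1).1
  have h2 : i ∉ c.E ∪ setR Lw Hr := fun h => (Finset.mem_union.mp h).elim
    (fun h => hL (c.E_subset_low h)) (fun h => hL (Finset.mem_inter.mp h).1)
  have h3 : i ∉ setF Lw Hr := fun h' =>
    Finset.mem_compl.mp (Finset.mem_inter.mp h).2 (Finset.mem_inter.mp h').2
  rw [c.uVec_of_mem_E ω _ (c.link ⟨i, h⟩).2, Scheme.uVec, dif_neg h1, dif_neg h2, dif_neg h3,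
    dif_pos h]

theorem Scheme.lik_received_mixedChannel {ρ : unitInterval} (hρ1 : (ρ : ℝ) < 1)
    (S : Fin T → Finset (Fin (2 ^ n))) (hpos : ∀ t, ∀ j ∈ S t, 0 < (ρ : ℝ)) (ω : c.Src)
    (t : Fin T) (i : Fin (2 ^ n)) :
    0 < (received n (fun _ => mixedChannel ρ) (c.yVec S ω t) (c.uVec ω t) i).lik (c.uVec ω t i) ∧
      (Zgen (S t) i = 0 →
        (received n (fun _ => mixedChannel ρ) (c.yVec S ω t) (c.uVec ω t) i).lik
          (c.uVec ω t i + 1) = 0) := by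
  have h := lik_received n (· ∈ S t) (fun _ => mixedChannel ρ) (c.yVec S ω t) (c.uVec ω t) ?_ ?_ i
  · exact ⟨h.1, fun hZ => h.2 (not_erased_of_Zgen_eq_zero hZ)⟩
  · intro j
    by_cases hj : j ∈ S t
    · simpa [Scheme.yVec, hj, mixedChannel, bec] using hpos t j hj
    · simpa [Scheme.yVec, hj, mixedChannel, bec, Scheme.xVec] using hρ1
  · intro j hj
    simp [Scheme.yVec, hj, mixedChannel, bec, Scheme.xVec]

/-- Induction on blocks, and within a block on positions. Earlier positions make the arg max see the
true past; earlier blocks supply the chained bits on B. -/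
theorem Scheme.IsSC.decode_eq {ρ : unitInterval} (hρ1 : (ρ : ℝ) < 1) {D : c.Decoder}
    (hD : c.IsSC ρ D) (S : Fin T → Finset (Fin (2 ^ n))) (hpos : ∀ t, ∀ j ∈ S t, 0 < (ρ : ℝ))
    (hZ : ∀ t, ∀ i ∈ Lw, Zgen (S t) i = 0) (ω : c.Src) (t : Fin T) (i : Fin (2 ^ n)) :
    D (c.yVec S ω) ω.2.2 t i = c.uVec ω t i := by
  induction t using WellFoundedLT.induction generalizing i with
  | ind t iht =>
  induction i using WellFoundedLT.induction with
  | ind i ihi =>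
  obtain ⟨hML, hF, hB0, hB⟩ := hD (c.yVec S ω) ω.2.2 t i
  by_cases hL : i ∈ Lw
  · have hML := hML (by rwa [setI_union_setR]) (c.uVec ω t i)
    rw [received_congr n (fun _ => mixedChannel ρ) (c.yVec S ω t) _ (c.uVec ω t) i ihi] at hML
    obtain ⟨h1, h0⟩ := c.lik_received_mixedChannel hρ1 S hpos ω t i
    refine (zmod_two_eq_or (c.uVec ω t i) _).resolve_right fun hne => ?_
    rw [hne, h0 (hZ t i hL)] at hML
    -- A wrong decision would have likelihood 0, below that of the true bit.
    exact absurd hML (not_le.mpr h1)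
  by_cases hH : i ∈ Hr
  · have hiF : i ∈ setF Lw Hr := Finset.mem_inter.mpr ⟨Finset.mem_compl.mpr hL, hH⟩
    rw [hF hiF, c.uVec_of_mem_setF ω t hiF]
  · have hiB : i ∈ setB Lw Hr :=
      Finset.mem_inter.mpr ⟨Finset.mem_compl.mpr hL, Finset.mem_compl.mpr hH⟩
    rw [c.uVec_of_mem_setB ω t hiB]
    split_ifs with ht
    · exact hB0 hiB ht
    · rw [hB hiB ⟨t - 1, lt_of_le_of_lt (Nat.sub_le _ _) t.2⟩ (by simp only; omega)]
      exact iht _ (by simp only [Fin.lt_def]; omega) _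

theorem Scheme.msgErr_le_blockErr (D : c.Decoder) (π : PMF c.Msg)
    (S : Fin T → Finset (Fin (2 ^ n))) : c.msgErr D π S ≤ c.blockErr D π S := by
  refine prob_mono _ fun ω hω => ?_
  by_contra hcon
  simp only [Set.mem_ofPred_eq, not_exists, not_not] at hcon
  refine hω (funext fun t => funext fun i => ?_)
  rw [hcon t i, Scheme.uVec, dif_pos i.2]

/-! ### The error bound for given erased sets -/

theorem Scheme.sum_nonneg_E (S : Fin T → Finset (Fin (2 ^ n))) :
    0 ≤ ∑ t ∈ Finset.univ.filter (fun t : Fin T => (t : ℕ) + 1 < T), ∑ i ∈ c.E, Zgen (S t) i :=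
  Finset.sum_nonneg fun _ _ => Finset.sum_nonneg fun _ _ => Zgen_nonneg _ _

theorem Scheme.one_le_bound (S : Fin T → Finset (Fin (2 ^ n))) {t : Fin T} {i : Fin (2 ^ n)}
    (hi : i ∈ Lw) (hZ : Zgen (S t) i ≠ 0) : 1 ≤ c.bound S := by
  rw [← (Zgen_eq_zero_or_one (S t) i).resolve_left hZ]
  have h1 : Zgen (S t) i ≤ ∑ i ∈ setI Lw Hr ∪ setR Lw Hr, Zgen (S t) i :=
    Finset.single_le_sum (f := Zgen (S t)) (fun _ _ => Zgen_nonneg _ _)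
      (by rwa [setI_union_setR])
  have h2 : ∑ i ∈ setI Lw Hr ∪ setR Lw Hr, Zgen (S t) i ≤
      ∑ t, ∑ i ∈ setI Lw Hr ∪ setR Lw Hr, Zgen (S t) i :=
    Finset.single_le_sum (f := fun t => ∑ i ∈ setI Lw Hr ∪ setR Lw Hr, Zgen (S t) i)
      (fun _ _ => Finset.sum_nonneg fun _ _ => Zgen_nonneg _ _) (Finset.mem_univ t)
  have h3 := c.sum_nonneg_E S
  simp only [Scheme.bound]
  linarith

theorem Scheme.bound_eq_zero_iff (S : Fin T → Finset (Fin (2 ^ n))) :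
    c.bound S = 0 ↔ ∀ t, ∀ i ∈ Lw, Zgen (S t) i = 0 := by
  refine ⟨fun h t i hi => ?_, fun h => ?_⟩
  · by_contra hZ
    have := c.one_le_bound S hi hZ
    linarith
  · rw [Scheme.bound, setI_union_setR, Finset.sum_eq_zero fun t _ => Finset.sum_eq_zero (h t),
      Finset.sum_eq_zero fun t _ => Finset.sum_eq_zero fun i hi => h t i (c.E_subset_low hi),
      add_zero]

theorem Scheme.IsSC.blockErr_eq_zero {ρ : unitInterval} (hρ1 : (ρ : ℝ) < 1) {D : c.Decoder}
    (hD : c.IsSC ρ D) (π : PMF c.Msg) (S : Fin T → Finset (Fin (2 ^ n)))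
    (hpos : ∀ t, ∀ j ∈ S t, 0 < (ρ : ℝ)) (hb : c.bound S = 0) : c.blockErr D π S = 0 := by
  have h : {ω | ∃ t i, D (c.yVec S ω) ω.2.2 t i ≠ c.uVec ω t i} = ∅ := by
    refine Set.eq_empty_of_forall_notMem fun ω => ?_
    rintro ⟨t, i, h⟩
    exact h (hD.decode_eq c hρ1 S hpos ((c.bound_eq_zero_iff S).mp hb) ω t i)
  rw [Scheme.blockErr, h, prob, MeasureTheory.measure_empty, ENNReal.toReal_zero]

/-- Either the bound is 0 and decoding is exact, or it is at least 1 and exceeds any probability. -/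
theorem Scheme.IsSC.blockErr_le_bound {ρ : unitInterval} (hρ1 : (ρ : ℝ) < 1) {D : c.Decoder}
    (hD : c.IsSC ρ D) (π : PMF c.Msg) (S : Fin T → Finset (Fin (2 ^ n)))
    (hpos : ∀ t, ∀ j ∈ S t, 0 < (ρ : ℝ)) : c.blockErr D π S ≤ c.bound S := by
  by_cases hb : c.bound S = 0
  · rw [hb, hD.blockErr_eq_zero c hρ1 π S hpos hb]
  · rw [c.bound_eq_zero_iff S] at hb
    push Not at hb
    obtain ⟨t, i, hi, hZ⟩ := hb
    exact (prob_le_one _ _).trans (c.one_le_bound S hi hZ)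

theorem Scheme.bound_const (hT : 1 ≤ T) (S : Finset (Fin (2 ^ n))) :
    c.bound (fun _ => S) = (T : ℝ) * ∑ i ∈ setI Lw Hr ∪ setR Lw Hr, Zgen S i +
      ((T : ℝ) - 1) * ∑ i ∈ c.E, Zgen S i := by
  obtain ⟨m, rfl⟩ := Nat.exists_eq_add_of_le' hT
  -- All blocks but the last hand bits on, which gives the factor `T - 1`.
  have hc : (Finset.univ.filter fun t : Fin (m + 1) => (t : ℕ) + 1 < m + 1).card = m := by
    simp only [add_lt_add_iff_right]
    exact Fin.card_filter_val_lt.trans (by omega)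
  simp only [Scheme.bound, Finset.sum_const, hc, Finset.card_univ, Fintype.card_fin, nsmul_eq_mul]
  push_cast
  ring

/-! ### Union bound over random erased sets -/

theorem Scheme.prob_bound_ne_zero_le {κ : PMF (Finset (Fin (2 ^ n)))}
    (μ : PMF (Fin T → Finset (Fin (2 ^ n)))) (hμ : ∀ t, μ.map (fun S => S t) = κ) {δ : ℝ}
    (hδ : ∀ i ∈ Lw, Pgen κ i ≤ δ) (hδ0 : 0 ≤ δ) :
    prob μ {S | c.bound S ≠ 0} ≤ T * 2 ^ n * δ := by
  have hsub : {S | c.bound S ≠ 0} ⊆ ⋃ p ∈ (Finset.univ : Finset (Fin T)) ×ˢ Lw,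
      {S : Fin T → Finset (Fin (2 ^ n)) | Zgen (S p.1) p.2 = 1} := by
    intro S hS
    rw [Set.mem_ofPred_eq, Ne, c.bound_eq_zero_iff S] at hS
    push Not at hS
    obtain ⟨t, i, hi, hZ⟩ := hS
    exact Set.mem_biUnion (x := (t, i)) (by simpa using hi)
      ((Zgen_eq_zero_or_one _ _).resolve_left hZ)
  calc prob μ {S | c.bound S ≠ 0} ≤ _ := prob_mono μ hsub
    _ ≤ _ := prob_biUnion_le μ _ _
    -- Each event concerns a single block, so only the marginals of `μ` are used.
    _ ≤ ∑ p ∈ (Finset.univ : Finset (Fin T)) ×ˢ Lw, δ := Finset.sum_le_sum fun p hp => by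
        have := hδ p.2 (Finset.mem_product.mp hp).2
        rwa [Pgen, ← hμ p.1, ← prob_preimage] at this
    _ = T * Lw.card * δ := by
        rw [Finset.sum_const, Finset.card_product, nsmul_eq_mul]
        simp
    _ ≤ T * 2 ^ n * δ := by
        have : (Lw.card : ℝ) ≤ 2 ^ n := by
          exact_mod_cast (Finset.card_le_univ Lw).trans_eq (Fintype.card_fin _)
        gcongr

theorem Scheme.sum_msgErr_le (D : c.Decoder) (π : PMF c.Msg)
    (μ : PMF (Fin T → Finset (Fin (2 ^ n)))) :
    ∑ S, (μ S).toReal * c.msgErr D π S ≤ prob μ {S | c.blockErr D π S ≠ 0} := by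
  rw [prob_eq_sum]
  refine Finset.sum_le_sum fun S _ => ?_
  by_cases hS : c.blockErr D π S = 0
  · have : c.msgErr D π S = 0 :=
      le_antisymm (hS ▸ c.msgErr_le_blockErr D π S) (prob_nonneg _ _)
    simp [hS, this]
  · rw [Set.indicator_of_mem hS]
    exact mul_le_of_le_one_right ENNReal.toReal_nonneg (prob_le_one _ _)

end Scheme

/-! Comparison of the uniform law on the sets of a given size with independent erasures. -/

/-- The weight of `j` under the binomial law with parameters `N` and `p`. -/
def binomWeight (p : ℝ) (N j : ℕ) : ℝ := N.choose j * (p ^ j * (1 - p) ^ (N - j))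

theorem binomWeight_nonneg {p : ℝ} (h0 : 0 ≤ p) (h1 : p ≤ 1) (N j : ℕ) : 0 ≤ binomWeight p N j := by
  have : 0 ≤ 1 - p := by linarith
  unfold binomWeight
  positivity

theorem sum_binomWeight (p : ℝ) (N : ℕ) : ∑ j ∈ Finset.range (N + 1), binomWeight p N j = 1 := by
  have h := add_pow p (1 - p) N
  rw [add_sub_cancel, one_pow] at h
  rw [h]
  exact Finset.sum_congr rfl fun j _ => by rw [binomWeight]; ring

/-- The ratio of consecutive weights without division; it yields monotonicity on either side of the
mean and the crude comparison of neighbours. -/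
theorem binomWeight_succ (p : ℝ) {N j : ℕ} (hj : j < N) :
    ((j : ℝ) + 1) * (1 - p) * binomWeight p N (j + 1) = (N - j) * p * binomWeight p N j := by
  have h : (N.choose (j + 1) : ℝ) * (j + 1) = N.choose j * (N - j) := by
    have := Nat.choose_succ_right_eq N j
    rw [← Nat.cast_sub hj.le]
    exact_mod_cast this
  have hN : N - j = N - (j + 1) + 1 := by omega
  simp only [binomWeight]
  rw [hN, pow_succ, pow_succ]
  linear_combination (1 - p) * (p ^ j * p * (1 - p) ^ (N - (j + 1))) * h

theorem binomWeight_le_succ {p : ℝ} (h0 : 0 ≤ p) (h1 : p < 1) {N j : ℕ} (hj : j < N)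
    (h : (j : ℝ) + 1 ≤ p * N) : binomWeight p N j ≤ binomWeight p N (j + 1) := by
  have hs := binomWeight_succ p hj
  have hb := binomWeight_nonneg h0 h1.le N j
  have hc : 0 < ((j : ℝ) + 1) * (1 - p) := mul_pos (by positivity) (by linarith)
  refine le_of_mul_le_mul_left ?_ hc
  rw [hs]
  exact mul_le_mul_of_nonneg_right (by linarith) hb

theorem binomWeight_succ_le {p : ℝ} (h0 : 0 < p) (h1 : p < 1) {N j : ℕ} (hj : j < N)
    (h : p * N ≤ j) : binomWeight p N (j + 1) ≤ binomWeight p N j := by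
  have hs := binomWeight_succ p hj
  have hb := binomWeight_nonneg h0.le h1.le N j
  have hc : 0 < ((j : ℝ) + 1) * (1 - p) := mul_pos (by positivity) (by linarith)
  refine le_of_mul_le_mul_left ?_ hc
  rw [hs]
  exact mul_le_mul_of_nonneg_right (by linarith) hb

theorem binomWeight_le_mul_succ {p : ℝ} (h0 : 0 < p) (h1 : p < 1) {N j : ℕ} (hj : j < N) :
    p * (1 - p) * binomWeight p N j ≤ N * binomWeight p N (j + 1) := by
  have hs := binomWeight_succ p hj
  have hb := binomWeight_nonneg h0.le h1.le N j
  have hb' := binomWeight_nonneg h0.le h1.le N (j + 1)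
  have hjN : (j : ℝ) + 1 ≤ N := by exact_mod_cast hj
  have hp : 0 < 1 - p := by linarith
  calc p * (1 - p) * binomWeight p N j ≤ (N - j) * p * binomWeight p N j := by
        refine mul_le_mul_of_nonneg_right ?_ hb
        nlinarith
    _ = ((j : ℝ) + 1) * (1 - p) * binomWeight p N (j + 1) := hs.symm
    _ ≤ N * binomWeight p N (j + 1) := by
        refine mul_le_mul_of_nonneg_right ?_ hb'
        nlinarith

theorem binomWeight_succ_le_mul {p : ℝ} (h0 : 0 < p) (h1 : p < 1) {N j : ℕ} (hj : j < N) :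
    p * (1 - p) * binomWeight p N (j + 1) ≤ N * binomWeight p N j := by
  have hs := binomWeight_succ p hj
  have hb := binomWeight_nonneg h0.le h1.le N j
  have hb' := binomWeight_nonneg h0.le h1.le N (j + 1)
  have hp : 0 < 1 - p := by linarith
  have hjN : (j : ℝ) + 1 ≤ N := by exact_mod_cast hj
  calc p * (1 - p) * binomWeight p N (j + 1)
      ≤ ((j : ℝ) + 1) * (1 - p) * binomWeight p N (j + 1) := by
        refine mul_le_mul_of_nonneg_right ?_ hb'
        nlinarith [mul_nonneg (Nat.cast_nonneg (α := ℝ) j) hp.le]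
    _ = (N - j) * p * binomWeight p N j := hs
    _ ≤ N * binomWeight p N j := by
        refine mul_le_mul_of_nonneg_right ?_ hb
        nlinarith

/-- The integer `k` need not be the mode. From `j` below `k` the weights increase up to `k - 1`,
from `j` above they increase down to `k + 1`; the last step to `k` may lose the factor `N / (p (1 -
p))`. -/
theorem binomWeight_le_of_near_mean {p : ℝ} (h0 : 0 < p) (h1 : p < 1) {N k : ℕ} (hN : 1 ≤ N)
    (hkN : k ≤ N) (hk : |(k : ℝ) - p * N| < 1) (j : ℕ) (hj : j ≤ N) :
    p * (1 - p) * binomWeight p N j ≤ N * binomWeight p N k := by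
  obtain ⟨hk1, hk2⟩ := abs_lt.mp hk
  have hp : 0 < p * (1 - p) := mul_pos h0 (by linarith)
  rcases lt_trichotomy j k with h | h | h
  · obtain ⟨m, rfl⟩ : ∃ m, k = m + 1 := ⟨k - 1, by omega⟩
    refine le_trans ?_ (binomWeight_le_mul_succ h0 h1 hkN)
    refine mul_le_mul_of_nonneg_left ?_ hp.le
    have hjm : j ≤ m := by omega
    clear h
    induction hjm using Nat.decreasingInduction with
    | self => exact le_rfl
    | of_succ l hl ih =>
      refine (binomWeight_le_succ h0.le h1 (by omega) ?_).trans (ih (by omega))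
      have : (l : ℝ) + 1 ≤ m := by exact_mod_cast hl
      push_cast at hk2
      linarith
  · subst h
    refine mul_le_mul_of_nonneg_right ?_ (binomWeight_nonneg h0.le h1.le N j)
    have : (1 : ℝ) ≤ N := by exact_mod_cast hN
    nlinarith
  · refine le_trans ?_ (binomWeight_succ_le_mul h0 h1 (lt_of_lt_of_le h hj))
    refine mul_le_mul_of_nonneg_left ?_ hp.le
    induction j, (show k + 1 ≤ j from h) using Nat.le_induction with
    | base => exact le_rfl
    | succ l hl ih =>
      refine (binomWeight_succ_le h0 h1 (by omega) ?_).trans (ih (by omega) (by omega))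
      have : (k : ℝ) + 1 ≤ l := by exact_mod_cast hl
      linarith

/-- The `N + 1` weights sum to 1, and each is dominated by the weight at `k`. -/
theorem le_binomWeight_of_near_mean {p : ℝ} (h0 : 0 < p) (h1 : p < 1) {N k : ℕ} (hN : 1 ≤ N)
    (hkN : k ≤ N) (hk : |(k : ℝ) - p * N| < 1) :
    p * (1 - p) ≤ (N + 1) * N * binomWeight p N k := by
  calc p * (1 - p) = ∑ j ∈ Finset.range (N + 1), p * (1 - p) * binomWeight p N j := by
        rw [← Finset.mul_sum, sum_binomWeight, mul_one]
    _ ≤ ∑ j ∈ Finset.range (N + 1), N * binomWeight p N k := Finset.sum_le_sum fun j hj =>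
        binomWeight_le_of_near_mean h0 h1 hN hkN hk j
          (Nat.lt_succ_iff.mp (Finset.mem_range.mp hj))
    _ = (N + 1) * N * binomWeight p N k := by
        rw [Finset.sum_const, Finset.card_range, nsmul_eq_mul]
        push_cast
        ring

/-- A lower bound, up to a constant, for the probability that the number of independent erasures is
the integer nearest to its mean. -/
theorem exists_binomWeight_lower_bound {p : ℝ} (h0 : 0 ≤ p) (h1 : p < 1) :
    ∃ a : ℝ, 0 < a ∧ ∀ N k : ℕ, 1 ≤ N → k ≤ N → |(k : ℝ) - p * N| < 1 →
      a ≤ (N + 1) * N * binomWeight p N k := by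
  rcases h0.eq_or_lt with rfl | h0
  · refine ⟨1, one_pos, fun N k hN _ hk => ?_⟩
    rw [zero_mul, sub_zero, abs_of_nonneg (Nat.cast_nonneg k)] at hk
    have hk : k = 0 := Nat.lt_one_iff.mp (by exact_mod_cast hk)
    have hN : (1 : ℝ) ≤ N := by exact_mod_cast hN
    subst hk
    simp only [binomWeight, Nat.choose_zero_right, pow_zero, sub_zero, one_pow, Nat.cast_one]
    nlinarith
  · exact ⟨p * (1 - p), mul_pos h0 (by linarith), fun N k hN hkN hk =>
      le_binomWeight_of_near_mean h0 h1 hN hkN hk⟩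

/-- Conditioned on having `k` elements, the independent set is uniform, and `binomWeight` is the
probability of that condition. -/
theorem binomWeight_mul_prob_le {p : ℝ} {n k : ℕ} (hk : k ≤ 2 ^ n)
    {ν κ : PMF (Finset (Fin (2 ^ n)))} (hν : IsIndepLaw p ν)
    (hκ : ∀ S, (κ S).toReal = if S.card = k then 1 / ((2 ^ n).choose k : ℝ) else 0)
    (A : Set (Finset (Fin (2 ^ n)))) :
    binomWeight p (2 ^ n) k * prob κ A ≤ prob ν A := by
  rw [prob_eq_sum, prob_eq_sum, Finset.mul_sum]
  refine Finset.sum_le_sum fun S _ => ?_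
  by_cases hS : S ∈ A
  · rw [Set.indicator_of_mem hS, Set.indicator_of_mem hS, hκ]
    split_ifs with hc
    · have hne : ((2 ^ n).choose k : ℝ) ≠ 0 := by exact_mod_cast (Nat.choose_pos hk).ne'
      rw [hν S, hc, binomWeight]
      exact le_of_eq (by field_simp)
    · rw [mul_zero]
      exact ENNReal.toReal_nonneg
  · simp [hS]

theorem IsIndepLaw.eq {p : ℝ} {n : ℕ} {ν κ : PMF (Finset (Fin (2 ^ n)))} (hν : IsIndepLaw p ν)
    (hκ : IsIndepLaw p κ) : κ = ν := PMF.ext fun S =>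
  (ENNReal.toReal_eq_toReal_iff' (κ.apply_ne_top S) (ν.apply_ne_top S)).mp
    ((hκ S).trans (hν S).symm)

/-- If the index sets are computed from the law of the erased sets or from independent erasures,
then the erasure probabilities of the low indices exceed `δ_N` at most by a polynomial factor. -/
theorem exists_Pgen_le_of_mem_lowSet {p : ℝ} (h0 : 0 ≤ p) (h1 : p < 1) (β : ℝ) :
    ∃ C : ℝ, 0 ≤ C ∧ ∀ (n : ℕ) (ν κ : PMF (Finset (Fin (2 ^ n)))), IsErasureLaw p κ →
      (κ = ν ∨ IsIndepLaw p ν) → ∀ i ∈ lowSet β ν,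
        Pgen κ i ≤ C * ((2 ^ n + 1) * 2 ^ n) * delta β n := by
  obtain ⟨a, ha, hab⟩ := exists_binomWeight_lower_bound h0 h1
  -- The summand 1 serves the case of equal laws, `1 / a` the change from independent erasures to a
  -- fixed size.
  refine ⟨1 + 1 / a, by positivity, fun n ν κ hκ hκν i hi => ?_⟩
  have hlow : Pgen ν i ≤ delta β n := (Finset.mem_filter.mp hi).2
  have hδ : 0 < delta β n := Real.rpow_pos_of_pos two_pos _
  have hN : (1 : ℝ) ≤ 2 ^ n := one_le_pow₀ one_le_two
  have hNN : (1 : ℝ) ≤ (2 ^ n + 1) * 2 ^ n := by nlinarith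
  have hsplit : (1 + 1 / a) * ((2 ^ n + 1) * 2 ^ n) * delta β n =
      (2 ^ n + 1) * 2 ^ n * delta β n + 1 / a * ((2 ^ n + 1) * 2 ^ n * delta β n) := by ring
  have key : κ = ν → Pgen κ i ≤ (1 + 1 / a) * ((2 ^ n + 1) * 2 ^ n) * delta β n := by
    rintro rfl
    have : delta β n ≤ (2 ^ n + 1) * 2 ^ n * delta β n := le_mul_of_one_le_left hδ.le hNN
    have : 0 ≤ 1 / a * ((2 ^ n + 1) * 2 ^ n * delta β n) := by positivity
    linarith
  rcases hκν with h | hν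
  · exact key h
  rcases hκ with hκ | ⟨k, hk, hkm, hκ⟩
  · exact key (hν.eq hκ)
  have hb := hab (2 ^ n) k Nat.one_le_two_pow hk (by exact_mod_cast hkm)
  have hmul := binomWeight_mul_prob_le hk hν hκ {S | Zgen S i = 1}
  change _ * Pgen κ i ≤ Pgen ν i at hmul
  have hP : 0 ≤ Pgen κ i := prob_nonneg _ _
  have h2 : a * Pgen κ i ≤ (2 ^ n + 1) * 2 ^ n * delta β n := by
    calc a * Pgen κ i ≤ ((2 ^ n + 1) * 2 ^ n * binomWeight p (2 ^ n) k) * Pgen κ i :=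
          mul_le_mul_of_nonneg_right (by exact_mod_cast hb) hP
      _ = (2 ^ n + 1) * 2 ^ n * (binomWeight p (2 ^ n) k * Pgen κ i) := by ring
      _ ≤ (2 ^ n + 1) * 2 ^ n * delta β n :=
          mul_le_mul_of_nonneg_left (hmul.trans hlow) (by positivity)
  have h3 : Pgen κ i ≤ 1 / a * ((2 ^ n + 1) * 2 ^ n * delta β n) := by
    rw [one_div, inv_mul_eq_div, le_div_iff₀ ha, mul_comm]
    exact h2
  have h4 : 0 ≤ (2 ^ n + 1) * 2 ^ n * delta β n := by positivity
  linarith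

/-! ### Decay of the union bound -/

theorem tendsto_pow_mul_delta {β : ℝ} (hβ : 0 < β) (k : ℕ) :
    Tendsto (fun n : ℕ => ((2 : ℝ) ^ n) ^ k * delta β n) atTop (nhds 0) := by
  have hx : Tendsto (fun n : ℕ => ((2 : ℝ) ^ n) ^ β) atTop atTop :=
    (tendsto_rpow_atTop hβ).comp (tendsto_pow_atTop_atTop_of_one_lt one_lt_two)
  -- With `x = N ^ β`, the term is `x ^ (k / β) * exp (-(log 2) * x)`.
  have h := (tendsto_rpow_mul_exp_neg_mul_atTop_nhds_zero (k / β) (Real.log 2)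
    (Real.log_pos one_lt_two)).comp hx
  refine h.congr fun n => ?_
  have hN : (0 : ℝ) ≤ 2 ^ n := by positivity
  simp only [Function.comp_apply, delta]
  rw [← Real.rpow_mul hN, mul_div_cancel₀ _ hβ.ne', Real.rpow_natCast,
    Real.rpow_def_of_pos two_pos]
  congr 2
  ring

theorem tendsto_union_bound {β : ℝ} (hβ : 0 < β) (T C : ℝ) :
    Tendsto (fun n : ℕ => T * 2 ^ n * (C * ((2 ^ n + 1) * 2 ^ n) * delta β n)) atTop (nhds 0) := by
  have h := ((tendsto_pow_mul_delta hβ 3).add (tendsto_pow_mul_delta hβ 2)).const_mul (T * C)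
  rw [add_zero, mul_zero] at h
  refine h.congr fun n => ?_
  ring

end AWTC

end

/-! ### The reliability theorem -/

theorem proposition2
    (ρw ρr : unitInterval) (hρ : (ρw : ℝ) + (ρr : ℝ) < 1)
    (β : ℝ) (hβ0 : 0 < β) (hβ : β < 1 / 2)
    (T : ℕ) (hT : 1 ≤ T)
    -- the laws of the erased sets from which the index sets of the scheme are computed
    (νw νr : ∀ n : ℕ, PMF (Finset (Fin (2 ^ n))))
    (hνw : ∀ n, AWTC.IsErasureLaw (ρw : ℝ) (νw n))
    (hνr : ∀ n, AWTC.IsErasureLaw (1 - (ρr : ℝ)) (νr n))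
    -- the law of the written set in each block: the one from which the index sets are computed, or
    -- any law of fraction `ρw` if the index sets are computed from independent erasures
    (κ : ∀ n : ℕ, PMF (Finset (Fin (2 ^ n))))
    (hκ : ∀ n, AWTC.IsErasureLaw (ρw : ℝ) (κ n))
    (hκν : ∀ n, κ n = νw n ∨ AWTC.IsIndepLaw (ρw : ℝ) (νw n)) :
    -- the error bound, for all written sets that the adversary may choose
    (∀ (n : ℕ) (c : AWTC.Scheme (AWTC.lowSet β (νw n)) (AWTC.highSet β (νr n)) T)
      (D : c.Decoder), c.IsSC ρw D → ∀ (π : PMF c.Msg) (S : Fin T → Finset (Fin (2 ^ n))),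
      (∀ t, S t ∈ (κ n).support) →
        c.msgErr D π S ≤ c.blockErr D π S ∧ c.blockErr D π S ≤ c.bound S) ∧
    -- the form of the bound when the same set is written in all blocks
    (∀ (n : ℕ) (c : AWTC.Scheme (AWTC.lowSet β (νw n)) (AWTC.highSet β (νr n)) T)
      (S : Finset (Fin (2 ^ n))),
      c.bound (fun _ => S) =
        (T : ℝ) * ∑ i ∈ AWTC.setI (AWTC.lowSet β (νw n)) (AWTC.highSet β (νr n)) ∪
            AWTC.setR (AWTC.lowSet β (νw n)) (AWTC.highSet β (νr n)), AWTC.Zgen S i +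
          ((T : ℝ) - 1) * ∑ i ∈ c.E, AWTC.Zgen S i) ∧
    -- reliability as the block length tends to infinity
    (∀ ε : ℝ, 0 < ε → ∀ᶠ n : ℕ in atTop,
      ∀ (c : AWTC.Scheme (AWTC.lowSet β (νw n)) (AWTC.highSet β (νr n)) T)
        (μ : PMF (Fin T → Finset (Fin (2 ^ n)))),
        (∀ t, μ.map (fun S => S t) = κ n) →
          1 - ε ≤ AWTC.prob μ {S | c.bound S = 0} ∧
          ∀ (D : c.Decoder), c.IsSC ρw D → ∀ π : PMF c.Msg,
            1 - ε ≤ AWTC.prob μ {S | c.blockErr D π S = 0} ∧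
            ∑ S, (μ S).toReal * c.msgErr D π S ≤ ε) := by
  have h0 : (0 : ℝ) ≤ ρw := ρw.2.1
  have h1 : (ρw : ℝ) < 1 := by
    have := ρr.2.1
    linarith
  have hpos : ∀ n, ∀ S : Fin T → Finset (Fin (2 ^ n)), (∀ t, S t ∈ (κ n).support) →
      ∀ t, ∀ j ∈ S t, 0 < (ρw : ℝ) := fun n S hS t j hj =>
    (hκ n).pos_of_mem_support h0 (hS t) hj
  refine ⟨fun n c D hD π S hS => ⟨c.msgErr_le_blockErr D π S,
    hD.blockErr_le_bound c h1 π S (hpos n S hS)⟩, fun n c S => c.bound_const hT S, ?_⟩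
  intro ε hε
  obtain ⟨C, hC, hP⟩ := AWTC.exists_Pgen_le_of_mem_lowSet h0 h1 β
  -- The threshold for `n` depends on `T`, `C`, `β` and `ε` only, hence the uniformity over scheme,
  -- decoder, message law and joint law.
  filter_upwards [(AWTC.tendsto_union_bound hβ0 T C).eventually_le_const hε] with n hn c μ hμ
  have hδ : 0 < AWTC.delta β n := Real.rpow_pos_of_pos two_pos _
  have hbound : AWTC.prob μ {S | c.bound S ≠ 0} ≤ ε :=
    (c.prob_bound_ne_zero_le μ hμ (hP n (νw n) (κ n) (hκ n) (hκν n)) (by positivity)).trans hn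
  have hsupp : ∀ S ∈ μ.support, ∀ t, S t ∈ (κ n).support := fun S hS t => by
    rw [← hμ t, PMF.support_map]
    exact Set.mem_image_of_mem _ hS
  have hcompl : ∀ f : (Fin T → Finset (Fin (2 ^ n))) → ℝ, AWTC.prob μ {S | f S ≠ 0} ≤ ε →
      1 - ε ≤ AWTC.prob μ {S | f S = 0} := fun f hf => by
    have := AWTC.prob_compl μ {S | f S = 0}
    change AWTC.prob μ {S | f S ≠ 0} = _ at this
    linarith
  refine ⟨hcompl _ hbound, fun D hD π => ?_⟩
  -- A zero bound forces zero error only for sets in the support, which suffices for the comparison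
  -- of probabilities.
  have hblock : AWTC.prob μ {S | c.blockErr D π S ≠ 0} ≤ ε :=
    (AWTC.prob_mono_on_support μ (A := {S | c.blockErr D π S ≠ 0})
      (B := {S | c.bound S ≠ 0}) fun S hS hSμ hb =>
      hS (hD.blockErr_eq_zero c h1 π S (hpos n S (hsupp S hSμ)) hb)).trans hbound
  exact ⟨hcompl _ hblock, (c.sum_msgErr_le D π μ).trans hblock⟩
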